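/- For $k\ge 1$ let $$f_k=(q^k;q^k)_\infty=\prod_{m=1}^{\infty}(1-q^{km}),$$ a formal power series in $q$. For $\ell\in\{3,9\}$ and $n\ge 0$, let $a_\ell(n)$ denote the number of $\ell$-regular cubic partitions of $n$, that is, of partitions of $n$ in which even parts may appear in two colours and no part is divisible by $\ell$; equivalently, $$\sum_{n\ge 0}a_\ell(n)q^n=\frac{f_\ell f_{2\ell}}{f_1f_2}.$$ Then, as identities of formal power series, $$\sum_{n\ge 0}a_3(3n+2)q^n=3\,\frac{f_3^3f_6^3}{f_1^3f_2^3} \qquad\text{and}\qquad \sum_{n\ge 0}a_9(3n+2)q^n=3\,\frac{f_3^4f_6^4}{f_1^4f_2^4}.$$ -/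

import Mathlib

open PowerSeries
open scoped PowerSeries.WithPiTopology

noncomputable section

/-- The formal power series `f_k = (q^k; q^k)_∞ = ∏_{m ≥ 1} (1 - q^{k m})` in `ℚ⟦q⟧`
(the index `m` below is shifted by one). -/
def eulerF (k : ℕ) : ℚ⟦X⟧ := ∏' m : ℕ, (1 - X ^ (k * (m + 1)))

/-- The `ℓ`-regular cubic partitions of `n`: partitions of `n` with no part divisible by `ℓ`, in
which every even part comes in one of two colours. Such an object is a pair `(lam, mu)` with
`|lam| + |mu| = n`, where `lam` collects the parts of the first colour and `mu` those of the second
colour (all of them even), and no part of `lam` or `mu` is divisible by `ℓ`. -/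
def regularCubicPartitions (ℓ n : ℕ) :
    Finset (Σ s : ℕ × ℕ, s.1.Partition × s.2.Partition) :=
  (Finset.HasAntidiagonal.antidiagonal n).sigma fun s =>
    Nat.Partition.restricted s.1 (fun i => ¬ ℓ ∣ i) ×ˢ
      Nat.Partition.restricted s.2 (fun i => 2 ∣ i ∧ ¬ ℓ ∣ i)

/-- `a_ℓ(n)`, the number of `ℓ`-regular cubic partitions of `n`. -/
def cubicCount (ℓ n : ℕ) : ℕ := (regularCubicPartitions ℓ n).card

/-- The infinite product defining `eulerF k` converges for `k ≥ 1`. -/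
theorem multipliable_eulerF {k : ℕ} (hk : 0 < k) :
    Multipliable fun m : ℕ => (1 - X ^ (k * (m + 1)) : ℚ⟦X⟧) := by
  simp_rw [sub_eq_add_neg]
  apply PowerSeries.WithPiTopology.multipliable_one_add_of_tendsto_order_atTop_nhds_top
  refine ENat.tendsto_nhds_top_iff_natCast_lt.mpr (fun n => Filter.eventually_atTop.mpr ⟨n, ?_⟩)
  intro m hm
  rw [order_neg, order_X_pow]
  norm_cast
  nlinarith

theorem constantCoeff_eulerF {k : ℕ} (hk : 0 < k) : constantCoeff (eulerF k) = 1 := by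
  rw [eulerF, (multipliable_eulerF hk).map_tprod (constantCoeff (R := ℚ))
    (WithPiTopology.continuous_constantCoeff ℚ)]
  simp [hk.ne']

theorem hasProd_eulerF {k : ℕ} (hk : 0 < k) :
    HasProd (fun i : ℕ => if k ∣ i + 1 then (1 - X ^ (i + 1) : ℚ⟦X⟧) else 1) (eulerF k) := by
  have hinj : Function.Injective (fun m : ℕ => k * (m + 1) - 1) := by
    intro a b h
    have h1 : 0 < k * (a + 1) := by positivity
    have h2 : 0 < k * (b + 1) := by positivity
    have h3 : k * (a + 1) = k * (b + 1) := by
      simp only at h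
      omega
    have := Nat.eq_of_mul_eq_mul_left hk h3
    omega
  rw [← hinj.hasProd_iff]
  · rw [eulerF]
    refine (multipliable_eulerF hk).hasProd.congr_fun ?_
    intro m
    have h1 : k * (m + 1) - 1 + 1 = k * (m + 1) := Nat.sub_add_cancel (by nlinarith)
    simp [h1]
  · intro i hi
    rw [if_neg]
    rintro ⟨j, hj⟩
    rcases j with _ | j
    · simp at hj
    · exact hi ⟨j, by simp only; omega⟩

theorem restricted_mul_eulerF {d e : ℕ} (hd : 0 < d) (he : 0 < e) (hde : d ∣ e)
    (p : ℕ → Prop) [DecidablePred p] (hp : ∀ i, p i ↔ d ∣ i ∧ ¬ e ∣ i) :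
    (PowerSeries.mk fun n => ((Nat.Partition.restricted n p).card : ℚ)) * eulerF d = eulerF e := by
  have h := (Nat.Partition.hasProd_powerSeriesMk_card_restricted ℚ p).mul (hasProd_eulerF hd)
  refine h.unique ?_
  refine (hasProd_eulerF he).congr_fun fun i => ?_
  simp only [hp]
  by_cases h1 : e ∣ i + 1
  · simp [h1, hde.trans h1]
  · by_cases h2 : d ∣ i + 1
    · simp only [h1, h2, pow_mul, not_false_eq_true, and_self, if_true, if_false]
      exact WithPiTopology.tsum_pow_mul_one_sub_of_constantCoeff_eq_zero (by simp)
    · simp [h1, h2]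

/-- For odd `ℓ`, `∑ a_ℓ(n) q^n = f_ℓ f_{2ℓ} / (f_1 f_2)`. -/
theorem cubicCount_genFun {ℓ : ℕ} (hℓ : Odd ℓ) :
    (PowerSeries.mk fun n => (cubicCount ℓ n : ℚ)) =
      eulerF ℓ * eulerF (2 * ℓ) * (eulerF 1 * eulerF 2)⁻¹ := by
  have hpos : 0 < ℓ := hℓ.pos
  rw [PowerSeries.eq_mul_inv_iff_mul_eq (by simp [constantCoeff_eulerF])]
  rw [← restricted_mul_eulerF one_pos hpos (one_dvd _) (fun i => ¬ ℓ ∣ i) (by simp),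
    ← restricted_mul_eulerF two_pos (by positivity : 0 < 2 * ℓ) (dvd_mul_right _ _)
      (fun i => 2 ∣ i ∧ ¬ ℓ ∣ i) ?_]
  · rw [mul_mul_mul_comm]
    congr 1
    ext n
    simp [coeff_mul, cubicCount, regularCubicPartitions, Finset.card_sigma, Finset.card_product]
  · intro i
    have hc : Nat.Coprime 2 ℓ := (Nat.coprime_two_left).2 hℓ
    constructor
    · rintro ⟨h1, h2⟩
      exact ⟨h1, fun h => h2 ((dvd_mul_left _ _).trans h)⟩
    · rintro ⟨h1, h2⟩
      exact ⟨h1, fun h => h2 (hc.mul_dvd_of_dvd_of_dvd h1 h)⟩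

end

/-! Write F for the generating function, so that F f_1 f_2 = f_ℓ f_{2ℓ} is a series in q^3 for ℓ =
3, 9. Extracting the exponents 2 mod 3 from F amounts to rationalizing 1/(f_1 f_2) over series in
q^3.

Ramanujan's theta functions give f_1 f_2 = φ(-q) ψ(q), with φ(-q) = f_1^2/f_2 and ψ(q) = f_2^2/f_1.
Splitting both theta sums by the index mod 3 yields f_1 f_2 = a - q b - 2 q^2 c, where a, b, c are
series in q^3, b = f_9 f_18 and ac = b^2 (`eulerF_one_mul_eulerF_two_dissection`). The product
formulas behind this come from the Jacobi triple product (`theta_eq_tprod`), obtained as the limit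
of a finite q-binomial identity.

The product of f_1 f_2 over q, ωq, ω^2 q with ω a primitive cube root of unity is the norm a^3 - 7
q^3 b^3 - 8 q^6 c^3. Computed on the infinite products, it equals (f_3 f_6)^4/(f_9 f_18)
(`cubic_norm_eq`). The product of the two conjugates of f_1 f_2 has q^2-part b^2 + 2ac = 3 b^2. This
is the source of the factor 3, and dividing by the norm gives both identities
(`mk_coeff_three_mul_add_two_mul`). -/

noncomputable section

/-! ### Gaussian binomial coefficients -/

/-- Gaussian binomial coefficients, defined by the `q`-Pascal recursion. -/
def gaussBinom {R : Type*} [CommRing R] (q : R) : ℕ → ℕ → R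
  | _, 0 => 1
  | 0, _ + 1 => 0
  | n + 1, k + 1 => gaussBinom q n k + q ^ (k + 1) * gaussBinom q n (k + 1)

/-- The finite `q`-Pochhammer symbol `(q; q)_n`. -/
def qFactor {R : Type*} [CommRing R] (q : R) (n : ℕ) : R :=
  ∏ i ∈ Finset.range n, (1 - q ^ (i + 1))

section Gauss

variable {R : Type*} [CommRing R] (q : R)

@[simp] theorem gaussBinom_zero_right (n : ℕ) : gaussBinom q n 0 = 1 := by
  cases n <;> rfl

theorem gaussBinom_succ_succ (n k : ℕ) :
    gaussBinom q (n + 1) (k + 1) =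
      gaussBinom q n k + q ^ (k + 1) * gaussBinom q n (k + 1) := rfl

theorem gaussBinom_of_lt {n k : ℕ} (h : n < k) : gaussBinom q n k = 0 := by
  induction n generalizing k with
  | zero => obtain ⟨k, rfl⟩ := Nat.exists_eq_succ_of_ne_zero h.ne'; rfl
  | succ n ih =>
    obtain ⟨k, rfl⟩ := Nat.exists_eq_succ_of_ne_zero (Nat.ne_zero_of_lt h)
    rw [Nat.succ_eq_add_one, gaussBinom_succ_succ, ih (by omega), ih (by omega)]
    simp

@[simp] theorem gaussBinom_self (n : ℕ) : gaussBinom q n n = 1 := by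
  induction n with
  | zero => rfl
  | succ n ih => rw [gaussBinom_succ_succ, ih, gaussBinom_of_lt q (by omega)]; simp

theorem qFactor_succ (n : ℕ) : qFactor q (n + 1) = qFactor q n * (1 - q ^ (n + 1)) :=
  Finset.prod_range_succ _ _

/-- Division-free form of the quotient formula for Gaussian binomials. Pascal's recursion reduces
(i+1, j+1) to (i, j+1) and (i+1, j), hence the nested induction. -/
theorem gaussBinom_mul_qFactor (i j : ℕ) :
    gaussBinom q (i + j) i * (qFactor q i * qFactor q j) = qFactor q (i + j) := by
  induction i generalizing j with
  | zero => simp [qFactor]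
  | succ i ihi =>
    induction j with
    | zero => simp [qFactor]
    | succ j ihj =>
      have h1 := ihi (j + 1)
      have h2 := ihj
      rw [show i + 1 + (j + 1) = (i + j + 1) + 1 by ring, gaussBinom_succ_succ]
      rw [show i + (j + 1) = i + j + 1 by ring] at h1
      rw [show i + 1 + j = i + j + 1 by ring] at h2
      rw [qFactor_succ q (i + j + 1)]
      rw [qFactor_succ] at h1 h2 ⊢
      rw [qFactor_succ q j]
      linear_combination (1 - q ^ (i + 1)) * h1 + q ^ (i + 1) * (1 - q ^ (j + 1)) * h2

/-- The second Pascal rule for Gaussian binomials. -/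
theorem gaussBinom_succ_succ' [IsDomain R] (hq : ∀ n, qFactor q n ≠ 0) {n k : ℕ} (h : k ≤ n) :
    gaussBinom q (n + 1) (k + 1) =
      gaussBinom q n (k + 1) + q ^ (n - k) * gaussBinom q n k := by
  obtain ⟨j, rfl⟩ := Nat.exists_eq_add_of_le h
  cases j with
  | zero => simp [gaussBinom_of_lt]
  | succ j =>
    have h0 := gaussBinom_mul_qFactor q (k + 1) (j + 1)
    have h1 := gaussBinom_mul_qFactor q k (j + 1)
    have h2 := gaussBinom_mul_qFactor q (k + 1) j
    rw [show k + 1 + (j + 1) = (k + j + 1) + 1 by ring] at h0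
    rw [show k + 1 + j = k + j + 1 by ring] at h2
    rw [show k + (j + 1) = k + j + 1 by ring] at h1 ⊢
    rw [show k + j + 1 - k = j + 1 by omega]
    apply mul_right_cancel₀ (mul_ne_zero (hq (k + 1)) (hq (j + 1)))
    rw [h0, qFactor_succ q (k + j + 1)]
    rw [qFactor_succ q j] at h1 ⊢
    rw [qFactor_succ q k] at h2 ⊢
    linear_combination (-(1 - q ^ (j + 1))) * h2 - q ^ (j + 1) * (1 - q ^ (k + 1)) * h1

/-- Summed form of the Pascal rule. It and its primed companion absorb one new factor of the finite
triple product into the sum. -/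
theorem sum_gaussBinom_succ (n : ℕ) (F : ℕ → R) :
    ∑ k ∈ Finset.range (n + 2), gaussBinom q (n + 1) k * F k =
      ∑ k ∈ Finset.range (n + 1), gaussBinom q n k * (F (k + 1) + q ^ k * F k) := by
  have h1 : ∑ k ∈ Finset.range (n + 1), gaussBinom q n k * (q ^ k * F k) =
      F 0 + ∑ k ∈ Finset.range (n + 1), gaussBinom q n (k + 1) * (q ^ (k + 1) * F (k + 1)) := by
    have := Finset.sum_range_succ (fun k => gaussBinom q n k * (q ^ k * F k)) (n + 1)
    rw [Finset.sum_range_succ', gaussBinom_of_lt q (Nat.lt_succ_self n)] at this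
    simp only [gaussBinom_zero_right, pow_zero, one_mul, zero_mul, add_zero] at this
    rw [← this, add_comm]
  simp only [mul_add, Finset.sum_add_distrib, h1]
  rw [Finset.sum_range_succ', add_left_comm, ← Finset.sum_add_distrib, add_comm]
  congr 1
  · simp
  · refine Finset.sum_congr rfl fun k _ => ?_
    rw [gaussBinom_succ_succ]
    ring

theorem sum_gaussBinom_succ' [IsDomain R] (hq : ∀ n, qFactor q n ≠ 0) (n : ℕ) (F : ℕ → R) :
    ∑ k ∈ Finset.range (n + 2), gaussBinom q (n + 1) k * F k =
      ∑ k ∈ Finset.range (n + 1), gaussBinom q n k * (F k + q ^ (n - k) * F (k + 1)) := by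
  have h1 : ∑ k ∈ Finset.range (n + 1), gaussBinom q n k * F k =
      F 0 + ∑ k ∈ Finset.range (n + 1), gaussBinom q n (k + 1) * F (k + 1) := by
    have := Finset.sum_range_succ (fun k => gaussBinom q n k * F k) (n + 1)
    rw [Finset.sum_range_succ', gaussBinom_of_lt q (Nat.lt_succ_self n)] at this
    simp only [gaussBinom_zero_right, one_mul, zero_mul, add_zero] at this
    rw [← this, add_comm]
  simp only [mul_add, Finset.sum_add_distrib, h1]
  rw [Finset.sum_range_succ', add_assoc, ← Finset.sum_add_distrib, add_comm]
  congr 1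
  · simp
  · refine Finset.sum_congr rfl fun k hk => ?_
    rw [gaussBinom_succ_succ' q hq (by simpa [Nat.lt_succ_iff] using hk)]
    ring

end Gauss

/-! ### Theta series and the finite triple product -/

/-- The exponent `a j(j+1)/2 + b j(j-1)/2` of the general theta function. -/
def thetaExp (a b : ℕ) (j : ℤ) : ℕ := a * (j * (j + 1) / 2).toNat + b * (j * (j - 1) / 2).toNat

theorem two_mul_thetaExp (a b : ℕ) (j : ℤ) :
    2 * (thetaExp a b j : ℤ) = a * (j * (j + 1)) + b * (j * (j - 1)) := by
  have h1 : 2 ∣ j * (j + 1) := (Int.even_mul_succ_self j).two_dvd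
  have h2 : 2 ∣ j * (j - 1) := (Int.even_mul_pred_self j).two_dvd
  have p1 : 0 ≤ j * (j + 1) := by
    rcases le_or_gt 0 j with h | h <;> nlinarith
  have p2 : 0 ≤ j * (j - 1) := by
    rcases le_or_gt j 0 with h | h <;> nlinarith
  rw [thetaExp]
  push_cast
  rw [Int.toNat_of_nonneg (Int.ediv_nonneg p1 (by norm_num)),
    Int.toNat_of_nonneg (Int.ediv_nonneg p2 (by norm_num))]
  linear_combination (a : ℤ) * Int.mul_ediv_cancel' h1 + (b : ℤ) * Int.mul_ediv_cancel' h2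

/-- Growth of the exponents, used for summability and for the error in the triple product limit. The
`+ 1` is needed: for a = 0 the term j = 1 has exponent 0. -/
theorem natAbs_le_thetaExp_add_one {a b : ℕ} (h : 0 < a + b) (j : ℤ) :
    j.natAbs ≤ thetaExp a b j + 1 := by
  have e := two_mul_thetaExp a b j
  zify
  have h' : (1 : ℤ) ≤ a + b := by exact_mod_cast h
  have ha : (0 : ℤ) ≤ a := by positivity
  have hb : (0 : ℤ) ≤ b := by positivity
  have key : |j| * (|j| - 1) ≤ 2 * (thetaExp a b j : ℤ) := by
    have hn : 0 ≤ |j| * (|j| - 1) := by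
      rcases eq_or_ne j 0 with rfl | hj
      · simp
      · have := Int.one_le_abs hj
        nlinarith
    rw [e]
    rcases le_total 0 j with hj | hj
    · rw [abs_of_nonneg hj] at *
      nlinarith [mul_nonneg ha hj]
    · rw [abs_of_nonpos hj] at *
      nlinarith [mul_nonneg hb (neg_nonneg.2 hj)]
  nlinarith [sq_nonneg (|j| - 1), sq_nonneg (|j| - 2)]

/-- The `j`-th term `s^j q^(a j(j+1)/2 + b j(j-1)/2)` of the theta function `f(s q^a, s q^b)`. -/
def thetaTerm (s : ℤˣ) (a b : ℕ) (j : ℤ) : ℚ⟦X⟧ := (((s ^ j : ℤˣ) : ℤ) : ℚ⟦X⟧) * X ^ thetaExp a b j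

/-- The next factor of the first product moves a theta term up by one index, at the cost of exactly
the power of q occurring in the second Pascal rule. `thetaTerm_mul_right` is the counterpart for the
second product and the first rule. -/
theorem thetaTerm_mul_left (s : ℤˣ) (a b : ℕ) {M N k : ℕ} (h : k ≤ M + N) :
    thetaTerm s a b (k - N) * (((s : ℤ) : ℚ⟦X⟧) * X ^ (a + (a + b) * M)) =
      (X ^ (a + b)) ^ (M + N - k) * thetaTerm s a b ((k + 1 : ℕ) - N) := by
  have e : thetaExp a b (k - N) + (a + (a + b) * M) =
      (a + b) * (M + N - k) + thetaExp a b ((k + 1 : ℕ) - N) := by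
    have h1 := two_mul_thetaExp a b (k - N)
    have h2 := two_mul_thetaExp a b ((k + 1 : ℕ) - N)
    zify [h]
    push_cast at h1 h2 ⊢
    linarith
  have e2 : ((k + 1 : ℕ) - N : ℤ) = (k - N) + 1 := by push_cast; ring
  have e3 : ((s ^ ((k + 1 : ℕ) - N : ℤ) : ℤˣ) : ℤ) = (s ^ ((k : ℤ) - N) : ℤˣ) * s := by
    rw [e2, zpow_add_one, Units.val_mul]
  unfold thetaTerm
  rw [e3]
  push_cast
  rw [← pow_mul, mul_mul_mul_comm, ← pow_add, e, pow_add]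
  push_cast
  ring

theorem thetaTerm_mul_right (s : ℤˣ) (a b N k : ℕ) :
    thetaTerm s a b (k - N) * (((s : ℤ) : ℚ⟦X⟧) * X ^ (b + (a + b) * N)) =
      (X ^ (a + b)) ^ k * thetaTerm s a b (k - (N + 1 : ℕ)) := by
  have e : thetaExp a b (k - N) + (b + (a + b) * N) =
      (a + b) * k + thetaExp a b (k - (N + 1 : ℕ)) := by
    have h1 := two_mul_thetaExp a b (k - N)
    have h2 := two_mul_thetaExp a b (k - (N + 1 : ℕ))
    zify
    push_cast at h1 h2 ⊢
    linarith
  have e2 : (k - (N + 1 : ℕ) : ℤ) = (k - N) - 1 := by push_cast; ring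
  have e3 : ((s ^ (k - (N + 1 : ℕ) : ℤ) : ℤˣ) : ℤ) = (s ^ ((k : ℤ) - N) : ℤˣ) * s := by
    rw [e2, zpow_sub_one, Units.val_mul, Int.units_inv_eq_self]
  unfold thetaTerm
  rw [e3, ← pow_mul, mul_mul_mul_comm, ← pow_add, e, pow_add]
  push_cast
  ring

theorem qFactor_X_pow_ne_zero {c : ℕ} (hc : 0 < c) (n : ℕ) : qFactor (X ^ c : ℚ⟦X⟧) n ≠ 0 := by
  intro h
  have := congrArg (constantCoeff (R := ℚ)) h
  simp [qFactor, map_prod, hc.ne'] at this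

/-- Finite form of the Jacobi triple product. -/
theorem finite_tripleProduct (s : ℤˣ) {a b : ℕ} (h : 0 < a + b) (M N : ℕ) :
    (∏ i ∈ Finset.range M, (1 + ((s : ℤ) : ℚ⟦X⟧) * X ^ (a + (a + b) * i))) *
      ∏ i ∈ Finset.range N, (1 + ((s : ℤ) : ℚ⟦X⟧) * X ^ (b + (a + b) * i)) =
    ∑ k ∈ Finset.range (M + N + 1), gaussBinom (X ^ (a + b)) (M + N) k *
      thetaTerm s a b (k - N) := by
  -- Raising N shifts the index k - N and calls for the first Pascal rule. Raising M leaves it fixed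
  -- and calls for the second; this is needed only at N = 0.
  induction N with
  | zero =>
    induction M with
    | zero => simp [thetaTerm, thetaExp]
    | succ M ih =>
      rw [Finset.prod_range_succ, mul_right_comm, ih, Finset.sum_mul]
      rw [show M + 1 + 0 + 1 = (M + 0) + 2 by ring, show M + 1 + 0 = M + 0 + 1 by ring,
        sum_gaussBinom_succ' _ (qFactor_X_pow_ne_zero h)]
      refine Finset.sum_congr rfl fun k hk => ?_
      have := thetaTerm_mul_left s a b (M := M) (N := 0) (k := k)
        (by simpa [Nat.lt_succ_iff] using hk)
      rw [add_zero] at this ⊢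
      rw [← this]
      ring
  | succ N ih =>
    rw [Finset.prod_range_succ, ← mul_assoc, ih, Finset.sum_mul]
    rw [show M + (N + 1) + 1 = (M + N) + 2 by ring, show M + (N + 1) = M + N + 1 by ring,
      sum_gaussBinom_succ]
    refine Finset.sum_congr rfl fun k hk => ?_
    rw [← thetaTerm_mul_right s a b, show ((k + 1 : ℕ) - (N + 1 : ℕ) : ℤ) = k - N by push_cast; ring]
    ring

/-- Ramanujan's theta function `f(s q^a, s q^b) = ∑ s^j q^(a j(j+1)/2 + b j(j-1)/2)`. -/
def theta (s : ℤˣ) (a b : ℕ) : ℚ⟦X⟧ := ∑' j : ℤ, thetaTerm s a b j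

theorem hasSum_theta (s : ℤˣ) {a b : ℕ} (h : 0 < a + b) :
    HasSum (thetaTerm s a b) (theta s a b) := by
  refine Summable.hasSum ?_
  rw [WithPiTopology.summable_iff_summable_coeff]
  intro d
  refine summable_of_hasFiniteSupport ((Set.finite_Icc (-(d + 1 : ℤ)) (d + 1)).subset ?_)
  intro j hj
  have hd : thetaExp a b j = d := by
    by_contra hne
    apply hj
    simp only [thetaTerm]
    rw [← map_intCast (C (R := ℚ)), coeff_C_mul, coeff_X_pow, if_neg (Ne.symm hne), mul_zero]
  have := natAbs_le_thetaExp_add_one h j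
  rw [Set.mem_Icc]
  omega

/-! ### The q-adic limit and the Jacobi triple product -/

theorem dvd_qFactor_sub {R : Type*} [CommRing R] (q : R) {m n : ℕ} (h : m ≤ n) :
    q ^ (m + 1) ∣ qFactor q n - qFactor q m := by
  induction n, h using Nat.le_induction with
  | base => simp
  | succ n hmn ih =>
    rw [qFactor_succ, show qFactor q n * (1 - q ^ (n + 1)) - qFactor q m =
      (qFactor q n - qFactor q m) - q ^ (n + 1) * qFactor q n by ring]
    exact dvd_sub ih (Dvd.dvd.mul_right (pow_dvd_pow _ (by omega)) _)

/-- Modulo q^(m+1) all of (q)_i, (q)_j, (q)_{i+j}, (q)_n agree with (q)_m, so the quotient formula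
becomes G (q)_m^2 ≡ (q)_m, and the unit (q)_m cancels. -/
theorem dvd_gaussBinom_mul_qFactor_sub_one {R : Type*} [CommRing R] (q : R)
    (hq : ∀ n, IsUnit (qFactor q n)) {i j m n : ℕ} (hi : m ≤ i) (hj : m ≤ j) (hn : m ≤ n) :
    q ^ (m + 1) ∣ gaussBinom q (i + j) i * qFactor q n - 1 := by
  obtain ⟨c1, h1⟩ := dvd_qFactor_sub q hi
  obtain ⟨c2, h2⟩ := dvd_qFactor_sub q hj
  obtain ⟨c3, h3⟩ := dvd_qFactor_sub q (hi.trans (Nat.le_add_right i j))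
  obtain ⟨c4, h4⟩ := dvd_qFactor_sub q hn
  have h0 := gaussBinom_mul_qFactor q i j
  rw [sub_eq_iff_eq_add] at h1 h2 h3 h4
  rw [← (hq m).dvd_mul_right, h4]
  rw [h1, h2, h3] at h0
  generalize gaussBinom q (i + j) i = G at *
  refine ⟨c3 - G * c1 * qFactor q m - G * c2 * qFactor q m - G * q ^ (m + 1) * c1 * c2
    + c4 * G * qFactor q m, ?_⟩
  linear_combination h0

theorem isUnit_qFactor_X_pow {c : ℕ} (hc : 0 < c) (n : ℕ) :
    IsUnit (qFactor (X ^ c : ℚ⟦X⟧) n) := by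
  rw [PowerSeries.isUnit_iff_constantCoeff]
  simp [qFactor, map_prod, hc.ne']

theorem X_pow_dvd_gaussBinom_sub_mul_thetaTerm (s : ℤˣ) {a b : ℕ} (h : 0 < a + b) {N k : ℕ}
    (hk : k ≤ N + N) :
    X ^ N ∣ (gaussBinom (X ^ (a + b)) (N + N) k * qFactor (X ^ (a + b)) N - 1) *
      thetaTerm s a b (k - N) := by
  -- Here m = N - |k - N| is the minimum of k and 2N - k. The congruence is weak near the ends of
  -- the range, where the theta term is itself divisible by a high power of X; together the
  -- exponents reach N.
  have h1 := dvd_gaussBinom_mul_qFactor_sub_one (X ^ (a + b) : ℚ⟦X⟧) (isUnit_qFactor_X_pow h)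
    (i := k) (j := N + N - k) (m := N - ((k : ℤ) - N).natAbs) (n := N) (by omega) (by omega)
    (by omega)
  rw [Nat.add_sub_cancel' hk] at h1
  have h2 : (X ^ thetaExp a b (k - N) : ℚ⟦X⟧) ∣ thetaTerm s a b (k - N) := Dvd.intro_left _ rfl
  refine dvd_trans ?_ (mul_dvd_mul h1 h2)
  rw [← pow_mul, ← pow_add]
  refine pow_dvd_pow _ ?_
  have h3 := natAbs_le_thetaExp_add_one h ((k : ℤ) - N)
  have h4 := Nat.le_mul_of_pos_left (N - ((k : ℤ) - N).natAbs + 1) h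
  omega

theorem sum_range_int_sub {M : Type*} [AddCommMonoid M] (f : ℤ → M) (N : ℕ) :
    ∑ k ∈ Finset.range (N + N + 1), f (k - N) = ∑ j ∈ Finset.Icc (-N : ℤ) N, f j := by
  refine Finset.sum_nbij' (fun k => (k : ℤ) - N) (fun j => (j + N).toNat) ?_ ?_ ?_ ?_ ?_
  · intro k hk; simp only [Finset.mem_range] at hk; simp only [Finset.mem_Icc]; omega
  · intro j hj; simp only [Finset.mem_Icc] at hj; simp only [Finset.mem_range]; omega
  · intro k hk; simp
  · intro j hj; simp only [Finset.mem_Icc] at hj; omega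
  · intro k hk; rfl

theorem tendsto_of_X_pow_dvd_sub {u v : ℕ → ℚ⟦X⟧} {l : ℚ⟦X⟧} (h : ∀ N, X ^ N ∣ u N - v N)
    (hv : Filter.Tendsto v Filter.atTop (nhds l)) : Filter.Tendsto u Filter.atTop (nhds l) := by
  rw [WithPiTopology.tendsto_iff_coeff_tendsto] at hv ⊢
  intro d
  refine (hv d).congr' ?_
  filter_upwards [Filter.eventually_gt_atTop d] with N hN
  have := X_pow_dvd_iff.1 (h N) d hN
  rw [map_sub, sub_eq_zero] at this
  exact this.symm

theorem multipliable_one_add_sign_mul_X_pow (s : ℤˣ) (a : ℕ) {c : ℕ} (hc : 0 < c) :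
    Multipliable fun m : ℕ => 1 + ((s : ℤ) : ℚ⟦X⟧) * X ^ (a + c * m) := by
  apply PowerSeries.WithPiTopology.multipliable_one_add_of_tendsto_order_atTop_nhds_top
  refine ENat.tendsto_nhds_top_iff_natCast_lt.mpr
    (fun n => Filter.eventually_atTop.mpr ⟨n + 1, ?_⟩)
  intro m hm
  refine lt_of_lt_of_le ?_ (le_order_mul _ _)
  rw [order_X_pow]
  refine lt_of_lt_of_le ?_ le_add_self
  norm_cast
  nlinarith

/-- The Jacobi triple product identity. -/
theorem theta_eq_tprod (s : ℤˣ) {a b : ℕ} (h : 0 < a + b) :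
    theta s a b = (∏' m : ℕ, (1 + ((s : ℤ) : ℚ⟦X⟧) * X ^ (a + (a + b) * m))) *
      (∏' m : ℕ, (1 + ((s : ℤ) : ℚ⟦X⟧) * X ^ (b + (a + b) * m))) * eulerF (a + b) := by
  have t1 := (multipliable_one_add_sign_mul_X_pow s a h).hasProd.tendsto_prod_nat
  have t2 := (multipliable_one_add_sign_mul_X_pow s b h).hasProd.tendsto_prod_nat
  have t3 := (multipliable_eulerF h).hasProd.tendsto_prod_nat
  refine tendsto_nhds_unique (tendsto_of_X_pow_dvd_sub (fun N => ?_)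
    ((hasSum_theta s h).comp Finset.tendsto_Icc_neg))
    ((t1.mul t2).mul t3)
  simp only [Function.comp_apply]
  rw [← sum_range_int_sub, finite_tripleProduct s h, Finset.sum_mul, ← Finset.sum_sub_distrib]
  refine Finset.dvd_sum fun k hk => ?_
  have := X_pow_dvd_gaussBinom_sub_mul_thetaTerm s h (N := N) (k := k)
    (by simpa [Nat.lt_succ_iff] using hk)
  convert this using 1
  simp only [qFactor, pow_mul]
  ring

/-! ### Substitution q → q^t and product formulas for special theta functions -/

theorem continuous_expand {t : ℕ} (ht : t ≠ 0) :
    Continuous (expand t ht : ℚ⟦X⟧ →ₐ[ℚ] ℚ⟦X⟧) := by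
  rw [continuous_iff_continuousAt]
  intro f
  refine (WithPiTopology.tendsto_iff_coeff_tendsto _ _ _ _).2 fun d => ?_
  simp only [coeff_expand]
  split_ifs
  · exact (WithPiTopology.continuous_coeff ℚ _).continuousAt
  · exact tendsto_const_nhds

theorem expand_eulerF {t k : ℕ} (ht : t ≠ 0) (hk : 0 < k) :
    expand t ht (eulerF k) = eulerF (t * k) := by
  rw [eulerF, (multipliable_eulerF hk).map_tprod (expand t ht) (continuous_expand ht)]
  simp [eulerF, ← pow_mul, mul_assoc]

/-- Indexing f_{tk} by i with factors 1 - q^(t(i+1)) lets 1 - q^(2n) = (1 - q^n)(1 + q^n) be used at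
a single index. -/
theorem hasProd_eulerF_mul {t k : ℕ} (ht : 0 < t) (hk : 0 < k) :
    HasProd (fun i : ℕ => if k ∣ i + 1 then (1 - X ^ (t * (i + 1)) : ℚ⟦X⟧) else 1)
      (eulerF (t * k)) := by
  rw [← expand_eulerF ht.ne' hk]
  refine ((hasProd_eulerF hk).map (expand t ht.ne') (continuous_expand ht.ne')).congr_fun ?_
  intro i
  simp only [Function.comp_apply]
  split_ifs <;> simp [← pow_mul]

theorem thetaExp_mul (t a b : ℕ) (j : ℤ) : thetaExp (t * a) (t * b) j = t * thetaExp a b j := by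
  unfold thetaExp
  ring

theorem expand_theta {t a b : ℕ} (ht : t ≠ 0) (s : ℤˣ) (h : 0 < a + b) :
    expand t ht (theta s a b) = theta s (t * a) (t * b) := by
  refine (((hasSum_theta s h).map (expand t ht) (continuous_expand ht)).congr_fun ?_).unique
    (hasSum_theta s (by rw [← mul_add]; positivity))
  intro j
  simp [thetaTerm, thetaExp_mul, ← pow_mul]

theorem hasProd_ite_mod {M : Type*} [CommMonoid M] [TopologicalSpace M] {g : ℕ → M} {P : M}
    {n r : ℕ} (hr : r < n) (h : HasProd (fun m => g (n * m + r)) P) :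
    HasProd (fun i => if i % n = r then g i else 1) P := by
  have hinj : Function.Injective (fun m : ℕ => n * m + r) := by
    intro x y hxy
    exact Nat.eq_of_mul_eq_mul_left (by omega : 0 < n) (Nat.add_right_cancel hxy)
  rw [← hinj.hasProd_iff]
  · refine h.congr_fun fun m => ?_
    simp [Nat.mod_eq_of_lt hr]
  · intro i hi
    rw [if_neg]
    intro hir
    exact hi ⟨i / n, by simp only; rw [← hir]; exact Nat.div_add_mod i n⟩

/-- Spreads a product over one residue class onto all indices. Product identities can then be
checked factor by factor, one residue at a time. -/
theorem hasProd_ite_mod_sign (s : ℤˣ) {r c : ℕ} (hr : r < c) :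
    HasProd (fun i => if i % c = r then 1 + ((s : ℤ) : ℚ⟦X⟧) * X ^ (i + 1) else 1)
      (∏' m : ℕ, (1 + ((s : ℤ) : ℚ⟦X⟧) * X ^ (r + 1 + c * m))) := by
  refine hasProd_ite_mod hr ?_
  refine (multipliable_one_add_sign_mul_X_pow s (r + 1) (by omega)).hasProd.congr_fun fun m => ?_
  rw [show r + 1 + c * m = c * m + r + 1 by ring]

theorem theta_neg_one_one_mul : theta (-1) 1 1 * eulerF 2 = eulerF 1 ^ 2 := by
  rw [theta_eq_tprod _ (by norm_num)]
  have h1 := hasProd_ite_mod_sign (-1) (r := 0) (c := 2) (by norm_num)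
  have h2 := hasProd_eulerF (k := 2) (by norm_num)
  have h3 := hasProd_eulerF (k := 1) (by norm_num)
  refine (((h1.mul h1).mul h2).mul h2).unique
    ((pow_two (eulerF 1)).symm ▸ (h3.mul h3).congr_fun ?_)
  intro i
  rcases Nat.mod_two_eq_zero_or_one i with h | h
  · have : ¬ 2 ∣ i + 1 := by omega
    simp [h, this]
    ring
  · have : 2 ∣ i + 1 := by omega
    simp [h, this]

theorem theta_neg_one_five_mul :
    theta (-1) 1 5 * eulerF 2 * eulerF 3 = eulerF 1 * eulerF 6 ^ 2 := by
  rw [theta_eq_tprod _ (by norm_num)]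
  have h1 := hasProd_ite_mod_sign (-1) (r := 0) (c := 6) (by norm_num)
  have h5 := hasProd_ite_mod_sign (-1) (r := 4) (c := 6) (by norm_num)
  have e6 := hasProd_eulerF (k := 6) (by norm_num)
  have e2 := hasProd_eulerF (k := 2) (by norm_num)
  have e3 := hasProd_eulerF (k := 3) (by norm_num)
  have e1 := hasProd_eulerF (k := 1) (by norm_num)
  refine (((((h1.mul h5).mul e6).mul e2).mul e3)).unique
    ((pow_two (eulerF 6)).symm ▸ (e1.mul (e6.mul e6)).congr_fun ?_)
  intro i
  have h6 : i % 6 < 6 := Nat.mod_lt _ (by norm_num)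
  have d2 : 2 ∣ i + 1 ↔ i % 6 = 1 ∨ i % 6 = 3 ∨ i % 6 = 5 := by omega
  have d3 : 3 ∣ i + 1 ↔ i % 6 = 2 ∨ i % 6 = 5 := by omega
  have d6 : 6 ∣ i + 1 ↔ i % 6 = 5 := by omega
  simp only [d2, d3, d6]
  generalize i % 6 = r at *
  interval_cases r <;> simp <;> ring

theorem theta_one_two_mul :
    theta 1 1 2 * eulerF 1 * eulerF 6 = eulerF 2 * eulerF 3 ^ 2 := by
  rw [theta_eq_tprod _ (by norm_num)]
  have h1 := hasProd_ite_mod_sign 1 (r := 0) (c := 3) (by norm_num)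
  have h2 := hasProd_ite_mod_sign 1 (r := 1) (c := 3) (by norm_num)
  have e3 := hasProd_eulerF (k := 3) (by norm_num)
  have e1 := hasProd_eulerF (k := 1) (by norm_num)
  have e2 := hasProd_eulerF_mul (t := 2) (k := 1) (by norm_num) (by norm_num)
  have e6 := hasProd_eulerF_mul (t := 2) (k := 3) (by norm_num) (by norm_num)
  refine (((((h1.mul h2).mul e3).mul e1).mul e6)).unique
    ((pow_two (eulerF 3)).symm ▸ (e2.mul (e3.mul e3)).congr_fun ?_)
  intro i
  have h6 : i % 3 < 3 := Nat.mod_lt _ (by norm_num)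
  have d3 : 3 ∣ i + 1 ↔ i % 3 = 2 := by omega
  simp only [d3, mul_comm 2, pow_mul]
  generalize i % 3 = r at *
  interval_cases r <;> simp <;> ring

theorem theta_zero_one_mul : theta 1 0 1 * eulerF 1 = 2 * eulerF 2 ^ 2 := by
  rw [theta_eq_tprod _ (by norm_num)]
  have h1 := hasProd_ite_mod_sign 1 (r := 0) (c := 1) (by norm_num)
  have e1 := hasProd_eulerF (k := 1) (by norm_num)
  have e2 := hasProd_eulerF_mul (t := 2) (k := 1) (by norm_num) (by norm_num)
  have key : (∏' m : ℕ, (1 + (((1 : ℤˣ) : ℤ) : ℚ⟦X⟧) * X ^ (1 + (0 + 1) * m))) * eulerF 1 =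
      eulerF 2 := by
    refine (h1.mul e1).unique (e2.congr_fun fun i => ?_)
    simp [Nat.mod_one, mul_comm 2, pow_mul]
    ring
  -- The factor at m = 0 is 1 + q^0 = 2, which is why this theta function is 2ψ(q).
  have h0 : (∏' m : ℕ, (1 + (((1 : ℤˣ) : ℤ) : ℚ⟦X⟧) * X ^ (0 + (0 + 1) * m))) =
      2 * ∏' m : ℕ, (1 + (((1 : ℤˣ) : ℤ) : ℚ⟦X⟧) * X ^ (1 + (0 + 1) * m)) := by
    have h := (multipliable_one_add_sign_mul_X_pow 1 1 (c := 0 + 1) (by norm_num)).hasProd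
    have := HasProd.zero_mul (f := fun m => 1 + (((1 : ℤˣ) : ℤ) : ℚ⟦X⟧) * X ^ (0 + (0 + 1) * m))
      (h.congr_fun fun m => by rw [show 1 + (0 + 1) * m = 0 + (0 + 1) * (m + 1) by ring])
    rw [this.tprod_eq]
    norm_num
  rw [h0]
  norm_num only at key ⊢
  linear_combination 2 * ((∏' m : ℕ, (1 + (((1 : ℤˣ) : ℤ) : ℚ⟦X⟧) * X ^ (1 + 1 * m))) *
    eulerF 1 + eulerF 2) * key

/-! ### Dissections modulo 3 of the theta functions and of f_1 f_2 -/

theorem HasSum.of_int_mod_three {M : Type*} [AddCommMonoid M] [TopologicalSpace M]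
    [ContinuousAdd M] {f : ℤ → M} {x y z : M} (h0 : HasSum (fun k => f (3 * k)) x)
    (h1 : HasSum (fun k => f (3 * k + 1)) y) (h2 : HasSum (fun k => f (3 * k - 1)) z) :
    HasSum f (x + y + z) := by
  have key : ∀ (r : ℤ) {w : M}, HasSum (fun k => f (3 * k + r)) w →
      HasSum (fun j => if (j - r) % 3 = 0 then f j else 0) w := by
    intro r w h
    have hinj : Function.Injective (fun k : ℤ => 3 * k + r) := fun a b hab => by
      simp only at hab; omega
    rw [← hinj.hasSum_iff]
    · refine h.congr_fun fun k => ?_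
      simp
    · intro j hj
      rw [if_neg]
      intro h3
      exact hj ⟨(j - r) / 3, by simp only; omega⟩
  have k0 := key 0 (by simpa using h0)
  have k1 := key 1 h1
  have k2 := key (-1) (by simpa [sub_eq_add_neg] using h2)
  refine ((k0.add k1).add k2).congr_fun fun j => ?_
  have : j % 3 = 0 ∨ j % 3 = 1 ∨ j % 3 = 2 := by omega
  rcases this with h | h | h
  · rw [if_pos (by omega), if_neg (by omega), if_neg (by omega)]; simp
  · rw [if_neg (by omega), if_pos (by omega), if_neg (by omega)]; simp
  · rw [if_neg (by omega), if_neg (by omega), if_pos (by omega)]; simp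

theorem theta_comm (s : ℤˣ) {a b : ℕ} (h : 0 < a + b) : theta s a b = theta s b a := by
  refine (((Equiv.neg ℤ).hasSum_iff.2 (hasSum_theta s h)).congr_fun fun j => ?_).unique
    (hasSum_theta s (by omega))
  have e : thetaExp a b (-j) = thetaExp b a j := by
    have h1 := two_mul_thetaExp a b (-j)
    have h2 := two_mul_thetaExp b a j
    zify
    linarith
  simp [thetaTerm, e]

theorem thetaTerm_eq_mul {s t u : ℤˣ} {a b c d e : ℕ} {i j : ℤ} (hs : s ^ i = u * t ^ j)
    (he : thetaExp a b i = e + thetaExp c d j) :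
    thetaTerm s a b i = ((u : ℤ) : ℚ⟦X⟧) * X ^ e * thetaTerm t c d j := by
  rw [thetaTerm, thetaTerm, hs, he, pow_add]
  push_cast
  ring

theorem Int.units_zpow_three_mul (s : ℤˣ) (k : ℤ) : s ^ (3 * k) = s ^ k := by
  rw [zpow_mul]
  congr 1
  rcases Int.units_eq_one_or s with rfl | rfl <;> rfl

/-- The exponent is j^2, and (3k ± 1)^2 = 9k^2 ± 6k + 1. The two nonzero classes give the same
series under k → -k. -/
theorem theta_neg_one_one_dissection :
    theta (-1) 1 1 = theta (-1) 9 9 - 2 * X * theta (-1) 3 15 := by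
  have hA := (hasSum_theta (-1) (a := 9) (b := 9) (by norm_num)).mul_left
    ((((1 : ℤˣ) : ℤ) : ℚ⟦X⟧) * X ^ 0)
  have hB := (hasSum_theta (-1) (a := 15) (b := 3) (by norm_num)).mul_left
    ((((-1 : ℤˣ) : ℤ) : ℚ⟦X⟧) * X ^ 1)
  have hC := (hasSum_theta (-1) (a := 3) (b := 15) (by norm_num)).mul_left
    ((((-1 : ℤˣ) : ℤ) : ℚ⟦X⟧) * X ^ 1)
  have := HasSum.of_int_mod_three (f := thetaTerm (-1) 1 1)
    (hA.congr_fun fun k => thetaTerm_eq_mul ?_ ?_) (hB.congr_fun fun k => thetaTerm_eq_mul ?_ ?_)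
    (hC.congr_fun fun k => thetaTerm_eq_mul ?_ ?_)
  · rw [theta_comm (-1) (a := 15) (by norm_num)] at this
    rw [(hasSum_theta (-1) (by norm_num)).unique this]
    push_cast
    ring
  · rw [Int.units_zpow_three_mul, one_mul]
  · have h1 := two_mul_thetaExp 1 1 (3 * k)
    have h2 := two_mul_thetaExp 9 9 k
    push_cast at h1 h2
    zify
    linarith
  · rw [zpow_add_one, Int.units_zpow_three_mul, mul_comm]
  · have h1 := two_mul_thetaExp 1 1 (3 * k + 1)
    have h2 := two_mul_thetaExp 15 3 k
    push_cast at h1 h2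
    zify
    linarith
  · rw [zpow_sub_one, Int.units_zpow_three_mul, mul_comm, Int.units_inv_eq_self]
  · have h1 := two_mul_thetaExp 1 1 (3 * k - 1)
    have h2 := two_mul_thetaExp 3 15 k
    push_cast at h1 h2
    zify
    linarith

/-- The exponent is j(j-1)/2, symmetric under j → 1 - j. This exchanges the classes 0 and 1 mod 3
and preserves the class of -1. -/
theorem theta_zero_one_dissection :
    theta 1 0 1 = 2 * theta 1 3 6 + X * theta 1 0 9 := by
  have hA := (hasSum_theta 1 (a := 3) (b := 6) (by norm_num)).mul_left
    ((((1 : ℤˣ) : ℤ) : ℚ⟦X⟧) * X ^ 0)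
  have hB := (hasSum_theta 1 (a := 6) (b := 3) (by norm_num)).mul_left
    ((((1 : ℤˣ) : ℤ) : ℚ⟦X⟧) * X ^ 0)
  have hC := (hasSum_theta 1 (a := 0) (b := 9) (by norm_num)).mul_left
    ((((1 : ℤˣ) : ℤ) : ℚ⟦X⟧) * X ^ 1)
  have := HasSum.of_int_mod_three (f := thetaTerm 1 0 1)
    (hA.congr_fun fun k => thetaTerm_eq_mul (by simp) ?_)
    (hB.congr_fun fun k => thetaTerm_eq_mul (by simp) ?_)
    (hC.congr_fun fun k => thetaTerm_eq_mul (by simp) ?_)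
  · rw [theta_comm 1 (a := 6) (by norm_num)] at this
    rw [(hasSum_theta 1 (by norm_num)).unique this]
    push_cast
    ring
  · have h1 := two_mul_thetaExp 0 1 (3 * k)
    have h2 := two_mul_thetaExp 3 6 k
    push_cast at h1 h2
    zify
    linarith
  · have h1 := two_mul_thetaExp 0 1 (3 * k + 1)
    have h2 := two_mul_thetaExp 6 3 k
    push_cast at h1 h2
    zify
    linarith
  · have h1 := two_mul_thetaExp 0 1 (3 * k - 1)
    have h2 := two_mul_thetaExp 0 9 k
    push_cast at h1 h2
    zify
    linarith

theorem eulerF_ne_zero {k : ℕ} (hk : 0 < k) : eulerF k ≠ 0 := by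
  intro h
  have := constantCoeff_eulerF hk
  simp [h] at this

/-- The 3-dissection of `f_1 f_2`. -/
theorem eulerF_one_mul_eulerF_two_dissection :
    ∃ α γ : ℚ⟦X⟧, α * γ = (eulerF 3 * eulerF 6) ^ 2 ∧
      eulerF 1 * eulerF 2 = expand 3 three_ne_zero α -
        X * expand 3 three_ne_zero (eulerF 3 * eulerF 6) -
        2 * X ^ 2 * expand 3 three_ne_zero γ := by
  have p3 : theta (-1) 3 3 * eulerF 6 = eulerF 3 ^ 2 := by
    have := congrArg (expand 3 three_ne_zero) theta_neg_one_one_mul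
    simpa [expand_theta, expand_eulerF] using this
  have q3 : theta 1 0 3 * eulerF 3 = 2 * eulerF 6 ^ 2 := by
    have := congrArg (expand 3 three_ne_zero) theta_zero_one_mul
    simpa [expand_theta, expand_eulerF, map_ofNat] using this
  have h1 := eulerF_ne_zero (k := 1) (by norm_num)
  have h2 := eulerF_ne_zero (k := 2) (by norm_num)
  have h3 := eulerF_ne_zero (k := 3) (by norm_num)
  have h6 := eulerF_ne_zero (k := 6) (by norm_num)
  have e1 : theta (-1) 3 3 * theta 1 0 3 = 2 * (eulerF 3 * eulerF 6) := by
    apply mul_right_cancel₀ (mul_ne_zero h3 h6)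
    linear_combination theta 1 0 3 * eulerF 3 * p3 + eulerF 3 ^ 2 * q3
  have e2 : theta (-1) 1 5 * theta 1 1 2 = eulerF 3 * eulerF 6 := by
    apply mul_right_cancel₀ (mul_ne_zero (mul_ne_zero h1 h2) (mul_ne_zero h3 h6))
    linear_combination theta 1 1 2 * eulerF 1 * eulerF 6 * theta_neg_one_five_mul +
      eulerF 1 * eulerF 6 ^ 2 * theta_one_two_mul
  have e3 : theta (-1) 1 1 * theta 1 0 1 = 2 * (eulerF 1 * eulerF 2) := by
    apply mul_right_cancel₀ (mul_ne_zero h1 h2)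
    linear_combination theta 1 0 1 * eulerF 1 * theta_neg_one_one_mul +
      eulerF 1 ^ 2 * theta_zero_one_mul
  have hc : (C (1 / 2 : ℚ)) * 2 = (1 : ℚ⟦X⟧) := by
    rw [← map_ofNat (C (R := ℚ)) 2, ← map_mul]
    norm_num
  -- With P, W the parts of φ(-q) and A, S those of 2ψ(q), half of (P - 2qW)(2A + qS) is PA + q(PS/2
  -- - 2WA) - q^2 WS. Since PS = 2b and WA = b, the middle coefficient is -b, and α = PA, γ = WS/2
  -- satisfy αγ = b^2.
  refine ⟨theta (-1) 3 3 * theta 1 1 2, C (1 / 2) * (theta (-1) 1 5 * theta 1 0 3), ?_, ?_⟩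
  · linear_combination C (1 / 2) * (theta (-1) 1 5 * theta 1 1 2) * e1 +
      (eulerF 3 * eulerF 6 * C (1 / 2) * 2) * e2 + (eulerF 3 * eulerF 6) ^ 2 * hc
  · have d1 := theta_neg_one_one_dissection
    have d2 := theta_zero_one_dissection
    have f1 := congrArg (expand 3 three_ne_zero) e1
    have f2 := congrArg (expand 3 three_ne_zero) e2
    have r1 : theta (-1) 9 9 = expand 3 three_ne_zero (theta (-1) 3 3) := by simp [expand_theta]
    have r2 : theta (-1) 3 15 = expand 3 three_ne_zero (theta (-1) 1 5) := by simp [expand_theta]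
    have r3 : theta 1 3 6 = expand 3 three_ne_zero (theta 1 1 2) := by simp [expand_theta]
    have r4 : theta 1 0 9 = expand 3 three_ne_zero (theta 1 0 3) := by simp [expand_theta]
    rw [r1, r2] at d1
    rw [r3, r4] at d2
    rw [d1, d2] at e3
    simp only [map_mul, map_ofNat, expand_C] at *
    apply mul_left_cancel₀ (right_ne_zero_of_mul_eq_one hc)
    generalize expand 3 three_ne_zero (theta (-1) 3 3) = P at *
    generalize expand 3 three_ne_zero (theta (-1) 1 5) = W at *
    generalize expand 3 three_ne_zero (theta 1 1 2) = A at *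
    generalize expand 3 three_ne_zero (theta 1 0 3) = S at *
    linear_combination -e3 + X * f1 - 4 * X * f2 + 2 * X ^ 2 * W * S * hc

/-! ### The norm over the cube roots of unity -/

theorem continuous_map_ratCast :
    Continuous (PowerSeries.map (algebraMap ℚ ℂ)) := by
  rw [continuous_iff_continuousAt]
  intro f
  refine (WithPiTopology.tendsto_iff_coeff_tendsto _ _ _ _).2 fun d => ?_
  simp only [coeff_map]
  have hc : Continuous (algebraMap ℚ ℂ) := continuous_algebraMap ℚ ℂ
  exact (hc.comp (WithPiTopology.continuous_coeff ℚ d)).continuousAt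

theorem continuous_rescale (w : ℂ) : Continuous (rescale w) := by
  rw [continuous_iff_continuousAt]
  intro f
  refine (WithPiTopology.tendsto_iff_coeff_tendsto _ _ _ _).2 fun d => ?_
  simp only [coeff_rescale]
  exact (continuous_const.mul (WithPiTopology.continuous_coeff ℂ d)).continuousAt

theorem rescale_map_expand {t : ℕ} (ht : t ≠ 0) {w : ℂ} (hw : w ^ t = 1) (f : ℚ⟦X⟧) :
    rescale w (PowerSeries.map (algebraMap ℚ ℂ) (expand t ht f)) =
      PowerSeries.map (algebraMap ℚ ℂ) (expand t ht f) := by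
  ext n
  rw [coeff_rescale, coeff_map, coeff_expand]
  split_ifs with h
  · obtain ⟨m, rfl⟩ := h
    rw [pow_mul, hw, one_pow, one_mul]
  · simp

theorem prod_cube_roots_one_sub {w : ℂ} (h : 1 + w + w ^ 2 = 0) (y : ℂ⟦X⟧) :
    (1 - y) * (1 - C w * y) * (1 - C (w ^ 2) * y) = 1 - y ^ 3 := by
  have h' : 1 + C w + C w ^ 2 = (0 : ℂ⟦X⟧) := by
    rw [← map_one (C (R := ℂ)), ← map_pow, ← map_add, ← map_add, h, map_zero]
  rw [map_pow]
  linear_combination (-y + C w * y ^ 2 + y ^ 3 - C w * y ^ 3) * h'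

theorem rescale_map_one_sub_X_pow (w : ℂ) (n : ℕ) :
    rescale w (PowerSeries.map (algebraMap ℚ ℂ) (1 - X ^ n)) = 1 - C (w ^ n) * X ^ n := by
  simp [mul_pow]

/-- The product of `f_k` over the cube roots of unity, for `k` prime to `3`. -/
theorem eulerF_mul_rescale {w : ℂ} (hw : 1 + w + w ^ 2 = 0) {k : ℕ} (hk : 0 < k)
    (h3 : ¬ 3 ∣ k) :
    PowerSeries.map (algebraMap ℚ ℂ) (eulerF k) *
      rescale w (PowerSeries.map (algebraMap ℚ ℂ) (eulerF k)) *
      rescale (w ^ 2) (PowerSeries.map (algebraMap ℚ ℂ) (eulerF k)) *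
      PowerSeries.map (algebraMap ℚ ℂ) (eulerF (9 * k)) =
    PowerSeries.map (algebraMap ℚ ℂ) (eulerF (3 * k)) ^ 4 := by
  have w3 : w ^ 3 = 1 := by linear_combination (w - 1) * hw
  have m0 := (multipliable_eulerF hk).hasProd.map (PowerSeries.map (algebraMap ℚ ℂ))
    continuous_map_ratCast
  have m1 := m0.map (rescale w) (continuous_rescale w)
  have m2 := m0.map (rescale (w ^ 2)) (continuous_rescale (w ^ 2))
  have e9 := (hasProd_eulerF_mul (t := k * 3) (k := 3) (by omega) (by norm_num)).map
    (PowerSeries.map (algebraMap ℚ ℂ)) continuous_map_ratCast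
  have e3 := (hasProd_eulerF_mul (t := k) (k := 3) hk (by norm_num)).map
    (PowerSeries.map (algebraMap ℚ ℂ)) continuous_map_ratCast
  have d3 := (multipliable_eulerF (k := 3 * k) (by omega)).hasProd.map
    (PowerSeries.map (algebraMap ℚ ℂ)) continuous_map_ratCast
  have H := ((m0.mul m1).mul m2).mul e9
  have H' := ((e3.mul e3).mul e3).mul d3
  rw [show k * 3 * 3 = 9 * k by ring] at H
  rw [mul_comm k 3] at H'
  refine (H.unique (H'.congr_fun fun i => ?_)).trans ?_
  · simp only [Function.comp_apply]
    -- With n = i + 1, the three conjugate factors multiply to (1 - q^(kn))^3 when 3 divides n, and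
    -- to 1 - q^(3kn) otherwise. The factor f_{9k} supplies the missing terms 1 - q^(3kn) with 3
    -- dividing n.
    by_cases h : 3 ∣ i + 1
    · obtain ⟨m, hm⟩ := h
      have r1 : w ^ (k * (3 * m)) = 1 := by
        rw [show k * (3 * m) = 3 * (k * m) by ring, pow_mul, w3, one_pow]
      have r2 : (w ^ 2) ^ (k * (3 * m)) = 1 := by rw [← pow_mul, mul_comm, pow_mul, r1, one_pow]
      rw [hm]
      simp only [dvd_mul_right, if_true, rescale_map_one_sub_X_pow]
      rw [r1, r2, show k * 3 * (3 * m) = 3 * k * (3 * m) by ring]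
      simp
    · have hn : ¬ 3 ∣ k * (i + 1) := by
        intro hd
        exact ((Nat.Prime.dvd_mul Nat.prime_three).1 hd).elim h3 h
      have r : 1 + w ^ (k * (i + 1)) + (w ^ (k * (i + 1))) ^ 2 = 0 := by
        generalize k * (i + 1) = n at hn
        rw [← Nat.div_add_mod n 3, pow_add, pow_mul, w3, one_pow, one_mul]
        have : n % 3 = 1 ∨ n % 3 = 2 := by omega
        rcases this with h | h
        · rw [h, pow_one, hw]
        · rw [h]
          linear_combination hw + w * w3
      simp only [h, if_false, rescale_map_one_sub_X_pow]
      simp only [map_sub, map_one, map_pow _ X, map_X, mul_one, one_mul]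
      rw [pow_right_comm w 2, prod_cube_roots_one_sub r, ← pow_mul]
      ring_nf
  · change PowerSeries.map (algebraMap ℚ ℂ) (eulerF (3 * k)) * _ * _ *
      PowerSeries.map (algebraMap ℚ ℂ) (eulerF (3 * k)) = _
    ring

/-- This is the factorization of a^3 + u^3 + v^3 - 3auv at u = -xb, v = -2x^2 c. The cross term is
-6 x^3 abc = -6 x^3 b^3, which turns the coefficient -1 of x^3 b^3 into -7. -/
theorem prod_cube_roots_of_mul_eq_sq {R : Type*} [CommRing R] {w a b c : R}
    (hw : 1 + w + w ^ 2 = 0) (h : a * c = b ^ 2) (x : R) :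
    (a - x * b - 2 * x ^ 2 * c) * (a - w * x * b - 2 * (w * x) ^ 2 * c) *
      (a - w ^ 2 * x * b - 2 * (w ^ 2 * x) ^ 2 * c) =
    a ^ 3 - 7 * x ^ 3 * b ^ 3 - 8 * (x ^ 3) ^ 2 * c ^ 3 := by
  have w3 : w ^ 3 = 1 := by linear_combination (w - 1) * hw
  have key : ∀ u v : R, (a + u + v) * (a + w * u + w ^ 2 * v) * (a + w ^ 2 * u + w * v) =
      a ^ 3 + u ^ 3 + v ^ 3 - 3 * a * u * v := by
    intro u v
    linear_combination (3 * a * u * v + a * u ^ 2 + a * v ^ 2 + a ^ 2 * u + a ^ 2 * v +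
      u * v ^ 2 + u ^ 2 * v) * hw + (a * u * v * w + a * u ^ 2 + a * v ^ 2 +
      u * v ^ 2 * (1 + w) + u ^ 2 * v * (1 + w) + u ^ 3 + v ^ 3) * w3
  have e : (w ^ 2 * x) ^ 2 = w * x ^ 2 := by linear_combination w * x ^ 2 * w3
  rw [e]
  linear_combination key (-(x * b)) (-(2 * x ^ 2 * c)) - 6 * x ^ 3 * b * h

/-- Both evaluations of the norm are compared after q → q^3 and over ℂ, where a primitive cube root
of unity exists. Both maps are injective, so the identity descends to ℚ⟦q⟧. -/
theorem cubic_norm_eq {α γ : ℚ⟦X⟧} (hαγ : α * γ = (eulerF 3 * eulerF 6) ^ 2)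
    (h : eulerF 1 * eulerF 2 = expand 3 three_ne_zero α -
        X * expand 3 three_ne_zero (eulerF 3 * eulerF 6) -
        2 * X ^ 2 * expand 3 three_ne_zero γ) :
    (α ^ 3 - 7 * X * (eulerF 3 * eulerF 6) ^ 3 - 8 * X ^ 2 * γ ^ 3) * (eulerF 3 * eulerF 6) =
      eulerF 1 ^ 4 * eulerF 2 ^ 4 := by
  obtain ⟨w, hw⟩ : ∃ w : ℂ, 1 + w + w ^ 2 = 0 := by
    -- A square root of -3 yields the primitive cube root (-1 + √-3)/2.
    obtain ⟨w, hw⟩ := IsAlgClosed.exists_pow_nat_eq (-3 : ℂ) (n := 2) (by norm_num)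
    exact ⟨(-1 + w) / 2, by linear_combination hw / 4⟩
  have w3 : w ^ 3 = 1 := by linear_combination (w - 1) * hw
  have hC : 1 + C w + C w ^ 2 = (0 : ℂ⟦X⟧) := by
    rw [← map_one (C (R := ℂ)), ← map_pow, ← map_add, ← map_add, hw, map_zero]
  have k1 := eulerF_mul_rescale hw (k := 1) (by norm_num) (by norm_num)
  have k2 := eulerF_mul_rescale hw (k := 2) (by norm_num) (by norm_num)
  have i3 : Function.Injective (expand 3 three_ne_zero : ℚ⟦X⟧ →ₐ[ℚ] ℚ⟦X⟧) := by
    intro f g hfg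
    ext n
    rw [← coeff_expand_mul 3 three_ne_zero, hfg, coeff_expand_mul]
  have hβ1 : PowerSeries.map (algebraMap ℚ ℂ) (eulerF 9) *
      PowerSeries.map (algebraMap ℚ ℂ) (eulerF 18) =
      PowerSeries.map (algebraMap ℚ ℂ) (expand 3 three_ne_zero (eulerF 3 * eulerF 6)) := by
    simp [expand_eulerF]
  have hN : PowerSeries.map (algebraMap ℚ ℂ) (expand 3 three_ne_zero
        (eulerF 1 ^ 4 * eulerF 2 ^ 4)) =
      PowerSeries.map (algebraMap ℚ ℂ) (eulerF 3) ^ 4 *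
        PowerSeries.map (algebraMap ℚ ℂ) (eulerF 6) ^ 4 := by
    simp [expand_eulerF]
  apply i3
  apply PowerSeries.map_injective (algebraMap ℚ ℂ) (algebraMap ℚ ℂ).injective
  rw [hN]
  generalize eulerF 3 * eulerF 6 = β at *
  have g : ∀ v : ℂ, v ^ 3 = 1 →
      rescale v (PowerSeries.map (algebraMap ℚ ℂ) (eulerF 1)) *
        rescale v (PowerSeries.map (algebraMap ℚ ℂ) (eulerF 2)) =
      PowerSeries.map (algebraMap ℚ ℂ) (expand 3 three_ne_zero α) -
        C v * X * PowerSeries.map (algebraMap ℚ ℂ) (expand 3 three_ne_zero β) -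
        2 * (C v * X) ^ 2 * PowerSeries.map (algebraMap ℚ ℂ) (expand 3 three_ne_zero γ) := by
    intro v hv
    rw [← map_mul, ← map_mul, h]
    simp only [map_sub, map_mul, map_pow, map_X, map_ofNat, rescale_X,
      rescale_map_expand three_ne_zero hv]
  have g0 := g 1 (one_pow 3)
  have g1 := g w w3
  have g2 := g (w ^ 2) (by rw [← pow_mul, mul_comm, pow_mul, w3, one_pow])
  have ab := congrArg (fun f => PowerSeries.map (algebraMap ℚ ℂ) (expand 3 three_ne_zero f)) hαγ
  simp only [map_mul, map_sub, map_pow, map_X, map_ofNat, expand_X, map_one, rescale_one,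
    RingHom.id_apply, one_mul] at g0 g1 g2 ab ⊢
  rw [← prod_cube_roots_of_mul_eq_sq hC ab, ← g0, ← g1, ← g2, ← hβ1]
  linear_combination (PowerSeries.map (algebraMap ℚ ℂ) (eulerF 2) *
      rescale w (PowerSeries.map (algebraMap ℚ ℂ) (eulerF 2)) *
      rescale (w ^ 2) (PowerSeries.map (algebraMap ℚ ℂ) (eulerF 2)) *
      PowerSeries.map (algebraMap ℚ ℂ) (eulerF 18)) * k1 +
    PowerSeries.map (algebraMap ℚ ℂ) (eulerF 3) ^ 4 * k2

/-! ### Extraction of the exponents 2 mod 3 -/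

theorem coeff_three_dissection (P Q S : ℚ⟦X⟧) (n : ℕ) :
    coeff (3 * n + 2) (expand 3 three_ne_zero P + X * expand 3 three_ne_zero Q +
      X ^ 2 * expand 3 three_ne_zero S) = coeff n S := by
  rw [map_add, map_add, coeff_expand_of_not_dvd _ _ _ (by omega), coeff_succ_X_mul,
    coeff_expand_of_not_dvd _ _ _ (by omega), coeff_X_pow_mul, coeff_expand_mul]
  simp

theorem three_dissection (F : ℚ⟦X⟧) :
    F = expand 3 three_ne_zero (mk fun n => coeff (3 * n) F) +
      X * expand 3 three_ne_zero (mk fun n => coeff (3 * n + 1) F) +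
      X ^ 2 * expand 3 three_ne_zero (mk fun n => coeff (3 * n + 2) F) := by
  ext n
  obtain ⟨m, rfl | rfl | rfl⟩ : ∃ m, n = 3 * m ∨ n = 3 * m + 1 ∨ n = 3 * m + 2 :=
    ⟨n / 3, by omega⟩
  · rw [map_add, map_add, coeff_expand_mul, coeff_mk]
    rcases m with _ | m
    · simp
    · rw [show 3 * (m + 1) = 3 * m + 1 + 1 + 1 by ring, coeff_succ_X_mul,
        coeff_expand_of_not_dvd _ _ _ (by omega), coeff_X_pow_mul',
        coeff_expand_of_not_dvd _ _ _ (by omega)]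
      simp
  · rw [map_add, map_add, coeff_expand_of_not_dvd _ _ _ (by omega), coeff_succ_X_mul,
      coeff_expand_mul, coeff_mk, coeff_X_pow_mul']
    split_ifs
    · rw [coeff_expand_of_not_dvd _ _ _ (by omega)]
      simp
    · simp
  · rw [coeff_three_dissection, coeff_mk]

/-- If `F f_1 f_2` is a series in `q^3`, this evaluates the part of `F` with exponents
`≡ 2 (mod 3)`. -/
theorem mk_coeff_three_mul_add_two_mul {F g : ℚ⟦X⟧}
    (h : F * (eulerF 1 * eulerF 2) = expand 3 three_ne_zero g) :
    (mk fun n => coeff (3 * n + 2) F) * (eulerF 1 ^ 4 * eulerF 2 ^ 4) =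
      3 * g * (eulerF 3 * eulerF 6) ^ 3 := by
  obtain ⟨α, γ, hαγ, hd⟩ := eulerF_one_mul_eulerF_two_dissection
  have hN := cubic_norm_eq hαγ hd
  have hF := three_dissection F
  set F0 : ℚ⟦X⟧ := mk fun n => coeff (3 * n) F
  set F1 : ℚ⟦X⟧ := mk fun n => coeff (3 * n + 1) F
  set F2 : ℚ⟦X⟧ := mk fun n => coeff (3 * n + 2) F
  rw [← hN]
  generalize eulerF 3 * eulerF 6 = β at *
  -- F times the norm equals F f_1 f_2 times the product of the two conjugates, a^2 + u^2 + v^2 - au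
  -- - av - uv with u = -qb, v = -2q^2 c. Its parts are a^2 - uv, v^2 - au and u^2 - av = q^2(b^2 +
  -- 2ac) = 3 q^2 b^2. The extra factor β clears the denominator of the norm.
  have key : expand 3 three_ne_zero
        (F0 * ((α ^ 3 - 7 * X * β ^ 3 - 8 * X ^ 2 * γ ^ 3) * β)) +
      X * expand 3 three_ne_zero (F1 * ((α ^ 3 - 7 * X * β ^ 3 - 8 * X ^ 2 * γ ^ 3) * β)) +
      X ^ 2 * expand 3 three_ne_zero
        (F2 * ((α ^ 3 - 7 * X * β ^ 3 - 8 * X ^ 2 * γ ^ 3) * β)) =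
      expand 3 three_ne_zero (g * β * (α ^ 2 - 2 * X * β * γ)) +
      X * expand 3 three_ne_zero (g * β * (α * β + 4 * X * γ ^ 2)) +
      X ^ 2 * expand 3 three_ne_zero (3 * g * β ^ 3) := by
    have ab := congrArg (expand 3 three_ne_zero) hαγ
    rw [hd] at h
    simp only [map_mul, map_sub, map_add, map_pow, map_ofNat, expand_X] at ab ⊢
    rw [← h]
    generalize expand 3 three_ne_zero F0 = G0 at *
    generalize expand 3 three_ne_zero F1 = G1 at *
    generalize expand 3 three_ne_zero F2 = G2 at *
    generalize expand 3 three_ne_zero α = a at *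
    generalize expand 3 three_ne_zero β = b at *
    generalize expand 3 three_ne_zero γ = c at *
    rw [hF]

    linear_combination (G0 + X * G1 + X ^ 2 * G2) * b *
      (2 * a * X ^ 2 + 4 * X ^ 3 * b - 4 * X ^ 4 * c) * ab
  ext n
  have := congrArg (coeff (3 * n + 2)) key
  rwa [coeff_three_dissection, coeff_three_dissection] at this

end

/-! ### The two identities -/

theorem mainTheorem5 :
    (PowerSeries.mk (fun n : ℕ => (cubicCount 3 (3 * n + 2) : ℚ)) =
      3 * (eulerF 3 ^ 3 * eulerF 6 ^ 3) * (eulerF 1 ^ 3 * eulerF 2 ^ 3)⁻¹) ∧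
    (PowerSeries.mk (fun n : ℕ => (cubicCount 9 (3 * n + 2) : ℚ)) =
      3 * (eulerF 3 ^ 4 * eulerF 6 ^ 4) * (eulerF 1 ^ 4 * eulerF 2 ^ 4)⁻¹) := by
  have h1 := constantCoeff_eulerF (k := 1) (by norm_num)
  have h2 := constantCoeff_eulerF (k := 2) (by norm_num)
  constructor
  · have h := cubicCount_genFun (ℓ := 3) (by decide)
    rw [eq_mul_inv_iff_mul_eq (by simp [h1, h2])] at h ⊢
    -- For ℓ = 3, F f_1 f_2 = f_3 f_6 is f_1 f_2 at q^3. One factor f_1 f_2 then cancels, leaving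
    -- cubes.
    have := mk_coeff_three_mul_add_two_mul (g := eulerF 1 * eulerF 2)
      (h.trans (by simp [expand_eulerF]))
    simp only [coeff_mk] at this
    apply mul_right_cancel₀ (mul_ne_zero (eulerF_ne_zero one_pos) (eulerF_ne_zero two_pos))
    linear_combination this
  · have h := cubicCount_genFun (ℓ := 9) (by decide)
    rw [eq_mul_inv_iff_mul_eq (by simp [h1, h2])] at h ⊢
    -- For ℓ = 9, F f_1 f_2 = f_9 f_18 is f_3 f_6 at q^3, which raises (f_3 f_6)^3 to a fourth
    -- power.
    have := mk_coeff_three_mul_add_two_mul (g := eulerF 3 * eulerF 6)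
      (h.trans (by simp [expand_eulerF]))
    simp only [coeff_mk] at this
    linear_combination this
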